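/- Recall that the permanent of a matrix $A=[a_{j,k}]_{1\le j,k\le n}$ over a field is $\operatorname{per}(A)=\sum_{\tau\in S_n}\prod_{j=1}^n a_{j,\tau(j)}$, where $S_n$ is the group of permutations of $\{1,\dots,n\}$. (i) Let $n$ be a positive integer, let $F$ be a field whose characteristic does not divide $n$, and let $\zeta\in F$ be a primitive $n$-th root of unity. Then, for any $x\in F$ with $x^n\neq 1$, $$\operatorname{per}\left[\frac1{1-\zeta^{j-k}x}\right]_{1\le j,k\le n}=\prod_{r=1}^n\left(\frac{n x^n}{1-x^n}+r\right).$$ (ii) For any prime $p\equiv 3\pmod 4$, $$\operatorname{per}\left[\frac1{j^2+k^2}\right]_{1\le j,k\le (p-1)/2}\equiv\frac{(-1)^{(p+1)/4}}{4\left(\frac{p+1}4!\right)^2}\pmod p,$$ where both sides are rational numbers whose denominators in lowest terms are not divisible by $p$, and the congruence means that $p$ divides the numerator of their difference in lowest terms. -/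

import Mathlib

/-- The permanent `per[a(j,k)]_{1 ≤ j,k ≤ n}`: rows and columns are numbered `1, …, n`. -/
def perOneTo {R : Type*} [CommRing R] (n : ℕ) (a : ℕ → ℕ → R) : R :=
  Matrix.permanent (Matrix.of fun j k : Fin n => a (j.val + 1) (k.val + 1))

/-- Congruence of rational numbers modulo `p`: both numbers are `p`-integral (for `p` prime this
says that `p` does not divide the denominator in lowest terms), and `p` divides the numerator
of the difference. -/
def RatModEq (p : ℕ) (x y : ℚ) : Prop :=
  ¬ p ∣ x.den ∧ ¬ p ∣ y.den ∧ (p : ℤ) ∣ (x - y).num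

/-! Borchardt's identity expresses a Cauchy permanent as a quotient of two determinants. At roots of
unity both matrices are circulant, so the same Vandermonde matrices diagonalise them; their
eigenvalues differ by the factors `n x ^ n / (1 - x ^ n) + s + 1` with `0 ≤ s < n`, whose product is
(i). For (ii), take `n = (p - 1) / 2`, which is odd, and `x = -1` over `ZMod p`. The squares `j ^ 2`
are the powers of a primitive `n`-th root of unity, so the permanent becomes `∏ (-n / 2 + r)`.
Modulo `p` this is a quotient of factorials, evaluated by Wilson's theorem. -/

open Finset Matrix Equiv in
/-- Borchardt's identity for the Cauchy-type matrix `[1 / (1 - u i * v j)]`. -/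
theorem det_mul_permanent_cauchy {F ι : Type*} [Field F] [Fintype ι] [DecidableEq ι]
    (u v : ι → F) (hu : ∀ i, u i ≠ 0) (hv : Function.Injective v)
    (h : ∀ i j, 1 - u i * v j ≠ 0) :
    (Matrix.of fun i j => 1 / (1 - u i * v j)).det *
      (Matrix.of fun i j => 1 / (1 - u i * v j)).permanent =
    (Matrix.of fun i j => (1 / (1 - u i * v j)) ^ 2).det := by
  set f : ι → ι → F := fun i j => 1 / (1 - u i * v j) with hf
  have expand : (Matrix.of f).det * (Matrix.of f).permanent =
      ∑ π : Perm ι, (Matrix.of fun i j => f i j * f i (π j)).det := by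
    simp only [det_apply', permanent, of_apply, sum_mul_sum]
    rw [sum_comm' (t' := univ) (s' := fun _ => univ) (by simp), sum_comm]
    conv_rhs => rw [sum_comm]
    refine sum_congr rfl fun σ _ => ?_
    -- With `σ` from the determinant fixed, the permanent's permutation is written as `σ * π⁻¹`.
    rw [← ((Equiv.inv (Perm ι)).trans (Equiv.mulLeft σ)).sum_comp]
    refine sum_congr rfl fun π _ => ?_
    rw [mul_assoc, prod_mul_distrib]
    congr 2
    rw [← Equiv.prod_comp π]
    simp
  have off (π : Perm ι) (hπ : π ≠ 1) : (Matrix.of fun i j => f i j * f i (π j)).det = 0 := by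
    rw [← exists_mulVec_eq_zero_iff]
    -- Partial fractions turn each row times this vector into a difference of two sums that agree
    -- after reindexing by `π`.
    refine ⟨fun j => v j - v (π j), fun h0 => hπ ?_, ?_⟩
    · ext j
      exact (hv (sub_eq_zero.mp (congrFun h0 j))).symm
    · ext i
      have key (j : ι) : f i j * f i (π j) * (v j - v (π j)) = (u i)⁻¹ * (f i j - f i (π j)) := by
        have h1 := h i j
        have h2 := h i (π j)
        have h3 := hu i
        simp only [hf]
        field_simp
        ring
      simp only [mulVec, dotProduct, of_apply, key, ← mul_sum, sum_sub_distrib, Pi.zero_apply]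
      rw [Equiv.sum_comp π (f i), sub_self, mul_zero]
  rw [expand, sum_eq_single 1 (fun π _ hπ => off π hπ) (by simp)]
  simp only [Perm.one_apply, ← sq, hf]

/-! ### Circulant matrices at roots of unity -/

open Finset in
theorem one_sub_mul_sum_succ_mul_pow {R : Type*} [CommRing R] (y : R) (n : ℕ) :
    (1 - y) * ∑ s ∈ range n, ((s : R) + 1) * y ^ s = ∑ s ∈ range n, y ^ s - n * y ^ n := by
  induction n with
  | zero => simp
  | succ n ih =>
    rw [sum_range_succ, sum_range_succ, mul_add, ih]
    push_cast
    ring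

-- The geometric series folded modulo `n`. The factor `1 - y ^ n` is constant along `y = ζ ^ m * x`,
-- so this is a Fourier expansion in `m`.
open Finset in
theorem sum_pow_div_one_sub_pow {F : Type*} [Field F] (y : F) (n : ℕ) (hy : y ^ n ≠ 1) :
    ∑ s ∈ range n, y ^ s / (1 - y ^ n) = 1 / (1 - y) := by
  have h1 : 1 - y ^ n ≠ 0 := sub_ne_zero.mpr hy.symm
  have h2 : 1 - y ≠ 0 := fun h => hy (by rw [← sub_eq_zero.mp h, one_pow])
  rw [← sum_div, div_eq_div_iff h1 h2, one_mul, geom_sum_mul_neg]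

open Finset in
theorem sum_pow_div_one_sub_pow_mul {F : Type*} [Field F] (y : F) (n : ℕ) (hy : y ^ n ≠ 1) :
    ∑ s ∈ range n, y ^ s / (1 - y ^ n) * (n * y ^ n / (1 - y ^ n) + ((s : F) + 1)) =
      (1 / (1 - y)) ^ 2 := by
  have h1 : 1 - y ^ n ≠ 0 := sub_ne_zero.mpr hy.symm
  have h2 : 1 - y ≠ 0 := fun h => hy (by rw [← sub_eq_zero.mp h, one_pow])
  have h3 := sum_pow_div_one_sub_pow y n hy
  have h4 : (1 - y) * (∑ s ∈ range n, y ^ s / (1 - y ^ n) * ((s : F) + 1)) =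
      1 / (1 - y) - n * y ^ n / (1 - y ^ n) := by
    have h5 := one_sub_mul_sum_succ_mul_pow y n
    rw [← h3, ← sum_div, ← sub_div, ← h5, mul_div_assoc, sum_div]
    congr 1
    exact sum_congr rfl fun s _ => by ring
  simp only [mul_add (_ / _ : F) (_ / _ : F), sum_add_distrib, ← sum_mul]
  rw [h3, ← mul_right_inj' h2, mul_add, h4]
  field_simp
  ring

open Finset Matrix in
/-- A matrix with entries `a (j - k)`, `a m = ∑ d s * g s * ζ ^ (m * s)`,
is diagonalised by the Vandermonde matrices of the powers of `ζ` and of `ζ⁻¹`. -/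
theorem det_circulant_of_sum {F : Type*} [Field F] (n : ℕ) (ζ : F) (hζ : ζ ≠ 0)
    (d g : ℕ → F) (a : ℤ → F)
    (ha : ∀ m : ℤ, a m = ∑ s ∈ range n, d s * g s * (ζ ^ m) ^ s) :
    (Matrix.of fun j k : Fin n => a ((j.val : ℤ) - k.val)).det =
      (vandermonde fun j : Fin n => ζ ^ j.val).det * (∏ s : Fin n, d s * g s) *
        (vandermonde fun j : Fin n => (ζ⁻¹) ^ j.val).det := by
  have : (Matrix.of fun j k : Fin n => a ((j.val : ℤ) - k.val)) =
      (vandermonde fun j : Fin n => ζ ^ j.val) * diagonal (fun s : Fin n => d s * g s) *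
        (vandermonde fun j : Fin n => (ζ⁻¹) ^ j.val)ᵀ := by
    ext j k
    rw [mul_apply, of_apply, ha, ← Fin.sum_univ_eq_sum_range (fun s => d s * g s * _)]
    refine sum_congr rfl fun s _ => ?_
    rw [mul_diagonal, vandermonde_apply, transpose_apply, vandermonde_apply, zpow_sub₀ hζ]
    simp only [zpow_natCast, div_eq_mul_inv, mul_pow, inv_pow]
    ring
  rw [this, det_mul, det_mul, det_diagonal, det_transpose]

open Finset in
theorem prod_Icc_one_eq_prod_range {M : Type*} [CommMonoid M] (f : ℕ → M) (n : ℕ) :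
    ∏ r ∈ Icc 1 n, f r = ∏ s ∈ range n, f (s + 1) := by
  induction n with
  | zero => simp
  | succ n ih => rw [prod_Icc_succ_top (by omega), prod_range_succ, ih]

open Finset Matrix in
theorem permanent_one_div_one_sub_root_mul {F : Type*} [Field F] (n : ℕ) (ζ x : F)
    (hn : 0 < n) (hζ : IsPrimitiveRoot ζ n) (hx : x ^ n ≠ 1) :
    (Matrix.of fun j k : Fin n => 1 / (1 - ζ ^ ((j.val : ℤ) - k.val) * x)).permanent =
      ∏ r ∈ Icc 1 n, ((n : F) * x ^ n / (1 - x ^ n) + (r : F)) := by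
  have hζ0 : ζ ≠ 0 := hζ.ne_zero hn.ne'
  have hprod : ∏ r ∈ Icc 1 n, ((n : F) * x ^ n / (1 - x ^ n) + (r : F)) =
      ∏ s : Fin n, ((n : F) * x ^ n / (1 - x ^ n) + ((s.val : F) + 1)) := by
    rw [prod_Icc_one_eq_prod_range,
      Fin.prod_univ_eq_prod_range (fun s => (n : F) * x ^ n / (1 - x ^ n) + ((s : F) + 1))]
    simp only [Nat.cast_succ]
  -- At `x = 0` all entries are 1, so for `n > 1` the determinant vanishes and cannot be cancelled;
  -- both sides equal `n!`.
  rcases eq_or_ne x 0 with rfl | hx0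
  · rw [hprod, Fin.prod_univ_eq_prod_range (fun s => (n : F) * 0 ^ n / (1 - 0 ^ n) + ((s : F) + 1))]
    simp [permanent, hn.ne', Fintype.card_perm, ← Finset.prod_range_add_one_eq_factorial]
  · have hpow (m : ℤ) : (ζ ^ m * x) ^ n = x ^ n := by
      rw [mul_pow, ← zpow_natCast, ← _root_.zpow_mul, mul_comm m, _root_.zpow_mul, zpow_natCast, hζ.pow_eq_one,
        _root_.one_zpow, one_mul]
    have hX : 1 - x ^ n ≠ 0 := sub_ne_zero.mpr hx.symm
    have hinj : Function.Injective fun j : Fin n => ζ ^ j.val := fun i j hij =>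
      Fin.ext (hζ.pow_inj i.2 j.2 hij)
    have hinj' : Function.Injective fun j : Fin n => (ζ⁻¹) ^ j.val := fun i j hij =>
      Fin.ext (hζ.inv.pow_inj i.2 j.2 hij)
    have hA := det_circulant_of_sum n ζ hζ0 (fun s => x ^ s / (1 - x ^ n)) (fun _ => 1)
      (fun m => 1 / (1 - ζ ^ m * x)) fun m => by
        rw [← sum_pow_div_one_sub_pow _ n (by rwa [hpow]), hpow]
        exact sum_congr rfl fun s _ => by ring
    have hB := det_circulant_of_sum n ζ hζ0 (fun s => x ^ s / (1 - x ^ n))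
      (fun s => (n : F) * x ^ n / (1 - x ^ n) + ((s : F) + 1))
      (fun m => (1 / (1 - ζ ^ m * x)) ^ 2) fun m => by
        rw [← sum_pow_div_one_sub_pow_mul _ n (by rwa [hpow]), hpow]
        exact sum_congr rfl fun s _ => by ring
    have hne : (Matrix.of fun j k : Fin n =>
        1 / (1 - ζ ^ ((j.val : ℤ) - k.val) * x)).det ≠ 0 := by
      rw [hA]
      refine mul_ne_zero (mul_ne_zero (det_vandermonde_ne_zero_iff.mpr hinj)
        (prod_ne_zero_iff.mpr fun s _ => ?_)) (det_vandermonde_ne_zero_iff.mpr hinj')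
      exact mul_ne_zero (div_ne_zero (pow_ne_zero _ hx0) hX) one_ne_zero
    have hsplit (j k : Fin n) : ζ ^ ((j.val : ℤ) - k.val) * x =
        ζ ^ j.val * x * (ζ⁻¹) ^ k.val := by
      rw [zpow_sub₀ hζ0]
      simp only [zpow_natCast, div_eq_mul_inv, inv_pow]
      ring
    have hbor := det_mul_permanent_cauchy (fun j : Fin n => ζ ^ j.val * x)
      (fun k : Fin n => (ζ⁻¹) ^ k.val) (fun j => mul_ne_zero (pow_ne_zero _ hζ0) hx0) hinj'
      fun j k h0 => hx <| by
        rw [← hpow ((j.val : ℤ) - k.val), hsplit, ← sub_eq_zero.mp h0, one_pow]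
    simp only [← hsplit] at hbor
    refine mul_left_cancel₀ hne ?_
    rw [hbor, hprod, hB, hA]
    simp only [prod_mul_distrib, prod_const_one]
    ring

/-! ### Residues of `p`-integral rationals -/

/-- The rational number `q` is `p`-integral and its residue modulo `p` is `z`. -/
def HasResidue (p : ℕ) [Fact p.Prime] (q : ℚ) (z : ZMod p) : Prop :=
  (q.den : ZMod p) ≠ 0 ∧ (q : ZMod p) = z

namespace HasResidue

variable {p : ℕ} [Fact p.Prime] {q r : ℚ} {z w : ZMod p}

theorem intCast (a : ℤ) : HasResidue p a a := by
  simp [HasResidue]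

theorem natCast (a : ℕ) : HasResidue p a a := by
  simp [HasResidue]

theorem den_ne_zero_of_dvd {m n : ℕ} (h : m ∣ n) (hn : (n : ZMod p) ≠ 0) : (m : ZMod p) ≠ 0 := by
  rintro h0
  obtain ⟨c, rfl⟩ := h
  simp [h0] at hn

theorem add (hq : HasResidue p q z) (hr : HasResidue p r w) : HasResidue p (q + r) (z + w) := by
  refine ⟨den_ne_zero_of_dvd (Rat.add_den_dvd q r) ?_, ?_⟩
  · push_cast
    exact mul_ne_zero hq.1 hr.1
  · rw [Rat.cast_add_of_ne_zero hq.1 hr.1, hq.2, hr.2]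

theorem mul (hq : HasResidue p q z) (hr : HasResidue p r w) : HasResidue p (q * r) (z * w) := by
  refine ⟨den_ne_zero_of_dvd (Rat.mul_den_dvd q r) ?_, ?_⟩
  · push_cast
    exact mul_ne_zero hq.1 hr.1
  · rw [Rat.cast_mul_of_ne_zero hq.1 hr.1, hq.2, hr.2]

theorem sub (hq : HasResidue p q z) (hr : HasResidue p r w) : HasResidue p (q - r) (z - w) := by
  simpa [sub_eq_add_neg] using hq.add ((intCast (-1)).mul hr)

theorem pow (hq : HasResidue p q z) (n : ℕ) : HasResidue p (q ^ n) (z ^ n) := by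
  induction n with
  | zero => simpa using natCast (p := p) 1
  | succ n ih => simpa [pow_succ] using ih.mul hq

theorem sum {ι : Type*} (s : Finset ι) {f : ι → ℚ} {g : ι → ZMod p}
    (h : ∀ i ∈ s, HasResidue p (f i) (g i)) : HasResidue p (∑ i ∈ s, f i) (∑ i ∈ s, g i) := by
  classical
  induction s using Finset.induction_on with
  | empty => simpa using natCast (p := p) 0
  | insert i s hi ih =>
    rw [Finset.sum_insert hi, Finset.sum_insert hi]
    exact (h i (by simp)).add (ih fun j hj => h j (by simp [hj]))

theorem prod {ι : Type*} (s : Finset ι) {f : ι → ℚ} {g : ι → ZMod p}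
    (h : ∀ i ∈ s, HasResidue p (f i) (g i)) : HasResidue p (∏ i ∈ s, f i) (∏ i ∈ s, g i) := by
  classical
  induction s using Finset.induction_on with
  | empty => simpa using natCast (p := p) 1
  | insert i s hi ih =>
    rw [Finset.prod_insert hi, Finset.prod_insert hi]
    exact (h i (by simp)).mul (ih fun j hj => h j (by simp [hj]))

theorem inv_natCast {a : ℕ} (ha : (a : ZMod p) ≠ 0) :
    HasResidue p ((a : ℚ)⁻¹) ((a : ZMod p)⁻¹) := by
  have ha0 : a ≠ 0 := by
    rintro rfl
    simp at ha
  refine ⟨by simpa [Rat.inv_natCast_den, ha0] using ha, ?_⟩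
  rw [Rat.cast_inv_of_ne_zero (by simpa using ha), Rat.cast_natCast]

theorem ratModEq (hq : HasResidue p q z) (hr : HasResidue p r z) : RatModEq p q r := by
  refine ⟨fun h => hq.1 ((ZMod.natCast_eq_zero_iff _ _).mpr h),
    fun h => hr.1 ((ZMod.natCast_eq_zero_iff _ _).mpr h), ?_⟩
  have h := hq.sub hr
  rw [sub_self] at h
  have h2 := h.2
  rw [Rat.cast_def, div_eq_zero_iff, or_iff_left h.1] at h2
  exact (ZMod.intCast_zmod_eq_zero_iff_dvd _ _).mp h2

end HasResidue

/-! ### Squares modulo `p` and Wilson's theorem -/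

theorem ZMod.exists_isPrimitiveRoot_of_dvd (p : ℕ) [Fact p.Prime] {n : ℕ} (hn : n ∣ p - 1) :
    ∃ ζ : ZMod p, IsPrimitiveRoot ζ n := by
  obtain ⟨g, hg⟩ := IsCyclic.exists_generator (α := (ZMod p)ˣ)
  obtain ⟨m, hm⟩ := hn
  have hord : orderOf g = p - 1 := by
    rw [orderOf_eq_card_of_forall_mem_zpowers hg, Nat.card_eq_fintype_card, ZMod.card_units]
  have hp : 0 < p - 1 := Nat.sub_pos_of_lt (Fact.out : p.Prime).one_lt
  have hprim : IsPrimitiveRoot ((g : ZMod p)) (p - 1) := by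
    rw [IsPrimitiveRoot.coe_units_iff, ← hord]
    exact IsPrimitiveRoot.orderOf g
  exact ⟨_, hprim.pow hp (hm.trans (mul_comm _ _))⟩

theorem ZMod.natCast_ne_zero_of_lt {p a : ℕ} (h0 : 0 < a) (h : a < p) : (a : ZMod p) ≠ 0 := by
  rw [Ne, ZMod.natCast_eq_zero_iff]
  exact Nat.not_dvd_of_pos_of_lt h0 h

theorem ZMod.sq_injOn_of_two_mul_lt {p : ℕ} [Fact p.Prime] {a b : ℕ} (ha : 0 < a)
    (hap : 2 * a < p) (hbp : 2 * b < p) (h : (a : ZMod p) ^ 2 = (b : ZMod p) ^ 2) : a = b := by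
  rcases sq_eq_sq_iff_eq_or_eq_neg.mp h with h | h
  · rw [ZMod.natCast_eq_natCast_iff'] at h
    rwa [Nat.mod_eq_of_lt (by omega), Nat.mod_eq_of_lt (by omega)] at h
  · refine absurd ?_ (ZMod.natCast_ne_zero_of_lt (p := p) (a := a + b) (by omega) (by omega))
    push_cast
    rw [h, neg_add_cancel]

/-- For a primitive root of unity `ζ` of order `(p - 1) / 2`, the residues
 `1 ^ 2, …, ((p - 1) / 2) ^ 2`
are a rearrangement of the powers of `ζ`. -/
theorem ZMod.exists_perm_sq_eq_pow {p : ℕ} [Fact p.Prime] (hp2 : p % 2 = 1) {ζ : ZMod p}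
    (hζ : IsPrimitiveRoot ζ ((p - 1) / 2)) :
    ∃ e : Equiv.Perm (Fin ((p - 1) / 2)), ∀ j : Fin ((p - 1) / 2),
      ((j.val + 1 : ℕ) : ZMod p) ^ 2 = ζ ^ (e j).val := by
  have hpp : 2 ≤ p := (Fact.out : p.Prime).two_le
  have hn : NeZero ((p - 1) / 2) := ⟨by omega⟩
  have hex (j : Fin ((p - 1) / 2)) : ∃ i : Fin ((p - 1) / 2),
      ((j.val + 1 : ℕ) : ZMod p) ^ 2 = ζ ^ i.val := by
    have := j.2
    obtain ⟨i, hi, h⟩ := hζ.eq_pow_of_pow_eq_one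
      (ξ := ((j.val + 1 : ℕ) : ZMod p) ^ 2) (by
        rw [← pow_mul, show 2 * ((p - 1) / 2) = p - 1 by omega]
        exact ZMod.pow_card_sub_one_eq_one (ZMod.natCast_ne_zero_of_lt (by omega) (by omega)))
    exact ⟨⟨i, hi⟩, h.symm⟩
  choose e he using hex
  have hinj : Function.Injective e := fun i j hij => by
    have hi := i.2
    have hj := j.2
    have h := (he i).trans ((congrArg (fun t => ζ ^ t.val) hij).trans (he j).symm)
    have := ZMod.sq_injOn_of_two_mul_lt (by omega) (by omega) (by omega) h
    exact Fin.ext (by omega)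
  exact ⟨Equiv.ofBijective e (Finite.injective_iff_bijective.mp hinj), he⟩

open Finset Matrix in
theorem IsPrimitiveRoot.permanent_one_div_pow_add_pow {F : Type*} [Field F] {n : ℕ} {ζ : F}
    (hn : Odd n) (h2 : (2 : F) ≠ 0) (hζ : IsPrimitiveRoot ζ n) :
    (Matrix.of fun j k : Fin n => 1 / (ζ ^ j.val + ζ ^ k.val)).permanent =
      ∏ r ∈ Icc 1 n, (-(n : F) / 2 + (r : F)) := by
  have hζ0 : ζ ≠ 0 := hζ.ne_zero hn.pos.ne'
  have hneg : (-1 : F) ^ n = -1 := hn.neg_one_pow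
  have h := permanent_one_div_one_sub_root_mul n ζ (-1) hn.pos hζ (by
    rw [hneg]
    intro h
    apply h2
    linear_combination -h)
  -- The exponent `n (n - 1) / 2` is a multiple of `n` because `n` is odd. Hence scaling column `k`
  -- by `ζ ^ k` preserves the permanent.
  have hprod : ∏ k : Fin n, ζ ^ k.val = 1 := by
    rw [Fin.prod_univ_eq_prod_range (fun k => ζ ^ k), prod_pow_eq_pow_sum, sum_range_id]
    obtain ⟨m, rfl⟩ := hn
    rw [show (2 * m + 1) * (2 * m + 1 - 1) / 2 = (2 * m + 1) * m by
      rw [Nat.add_sub_cancel, mul_left_comm, Nat.mul_div_cancel_left _ two_pos], pow_mul,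
      hζ.pow_eq_one, one_pow]
  have hscale : (Matrix.of fun j k : Fin n => 1 / (ζ ^ j.val + ζ ^ k.val)).permanent =
      (Matrix.of fun j k : Fin n => 1 / (1 - ζ ^ ((j.val : ℤ) - k.val) * (-1))).permanent := by
    refine sum_congr rfl fun σ _ => ?_
    calc _ = (∏ k : Fin n, ζ ^ k.val) * _ := by rw [hprod, one_mul]
      _ = _ := by
        rw [← prod_mul_distrib]
        refine prod_congr rfl fun k _ => ?_
        have hk : ζ ^ k.val ≠ 0 := pow_ne_zero _ hζ0
        rw [of_apply, of_apply, zpow_sub₀ hζ0, zpow_natCast, zpow_natCast,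
          show 1 - ζ ^ (σ k).val / ζ ^ k.val * (-1) = (ζ ^ (σ k).val + ζ ^ k.val) / ζ ^ k.val by
            field_simp
            ring]
        rw [one_div_div, mul_one_div]
  rw [hscale, h, hneg]
  refine prod_congr rfl fun r _ => ?_
  norm_num

open Finset Matrix in
theorem ZMod.permanent_one_div_sq_add_sq {p : ℕ} [Fact p.Prime] (hp : p % 4 = 3) :
    (Matrix.of fun j k : Fin ((p - 1) / 2) =>
      1 / (((j.val + 1 : ℕ) : ZMod p) ^ 2 + ((k.val + 1 : ℕ) : ZMod p) ^ 2)).permanent =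
      ∏ r ∈ Icc 1 ((p - 1) / 2), (-(((p - 1) / 2 : ℕ) : ZMod p) / 2 + (r : ZMod p)) := by
  obtain ⟨ζ, hζ⟩ := ZMod.exists_isPrimitiveRoot_of_dvd p (n := (p - 1) / 2)
    ⟨2, by omega⟩
  obtain ⟨e, he⟩ := ZMod.exists_perm_sq_eq_pow (by omega) hζ
  have h2 : (2 : ZMod p) ≠ 0 := by
    exact_mod_cast ZMod.natCast_ne_zero_of_lt (p := p) (a := 2) (by omega) (by omega)
  rw [← hζ.permanent_one_div_pow_add_pow (Nat.odd_iff.mpr (by omega)) h2,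
    ← permanent_permute_rows e (of fun j k => 1 / (ζ ^ _ + ζ ^ _)),
    ← permanent_permute_cols e (submatrix _ _ _)]
  simp only [he]
  rfl

-- Wilson's theorem is the case `m = 0`; the induction moves one factor across using `k + 1 = -(m +
-- 1)` modulo `p`.
open Nat in
theorem ZMod.factorial_mul_factorial {p : ℕ} [Fact p.Prime] (m k : ℕ) (h : m + k + 1 = p) :
    ((m ! : ℕ) : ZMod p) * (k ! : ℕ) = (-1) ^ (m + 1) := by
  induction m generalizing k with
  | zero =>
    rw [show k = p - 1 by omega, ZMod.wilsons_lemma]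
    simp
  | succ m ih =>
    have h0 : ((m + 1 + k + 1 : ℕ) : ZMod p) = 0 := by rw [h, ZMod.natCast_self]
    have h1 := ih (k + 1) (by omega)
    rw [Nat.factorial_succ] at h1 ⊢
    push_cast at h0 h1 ⊢
    rw [pow_succ, ← h1]
    linear_combination (m ! : ZMod p) * (k ! : ZMod p) * h0

open Nat in
theorem ZMod.four_mul_factorial_sq_ne_zero {p : ℕ} [Fact p.Prime] (hp : p % 4 = 3) :
    ((4 * ((p + 1) / 4)! ^ 2 : ℕ) : ZMod p) ≠ 0 := by
  have hpr : p.Prime := Fact.out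
  rw [Ne, ZMod.natCast_eq_zero_iff, hpr.dvd_mul, show 4 = 2 ^ 2 by rfl, not_or]
  refine ⟨fun h => ?_, fun h => ?_⟩
  · have := Nat.le_of_dvd two_pos (hpr.dvd_of_dvd_pow h)
    omega
  · have := hpr.dvd_factorial.mp (hpr.dvd_of_dvd_pow h)
    omega

open Finset Nat in
theorem ZMod.prod_quarter_add {p : ℕ} [Fact p.Prime] (hp : p % 4 = 3) :
    ∏ r ∈ Icc 1 ((p - 1) / 2), (-(((p - 1) / 2 : ℕ) : ZMod p) / 2 + (r : ZMod p)) =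
      (-1) ^ ((p + 1) / 4) * ((4 * ((p + 1) / 4)! ^ 2 : ℕ) : ZMod p)⁻¹ := by
  obtain ⟨m, rfl⟩ : ∃ m, p = 4 * m + 3 := ⟨p / 4, by omega⟩
  rw [show (4 * m + 3 - 1) / 2 = 2 * m + 1 by omega, show (4 * m + 3 + 1) / 4 = m + 1 by omega]
  have hp0 : (4 * m + 3 : ZMod (4 * m + 3)) = 0 := by
    exact_mod_cast ZMod.natCast_self (4 * m + 3)
  have h2 : (2 : ZMod (4 * m + 3)) ≠ 0 := by
    exact_mod_cast ZMod.natCast_ne_zero_of_lt (p := 4 * m + 3) (a := 2) (by omega) (by omega)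
  have hhalf : -((2 * m + 1 : ℕ) : ZMod (4 * m + 3)) / 2 = ((m + 1 : ℕ) : ZMod (4 * m + 3)) := by
    rw [div_eq_iff h2]
    push_cast
    linear_combination -hp0
  have hasc : (m + 1)! * ∏ r ∈ Icc 1 (2 * m + 1), (m + 1 + r) = (3 * m + 2)! := by
    rw [prod_Icc_one_eq_prod_range, show 3 * m + 2 = (m + 1) + (2 * m + 1) by omega,
      ← Nat.factorial_mul_ascFactorial (m + 1), Nat.ascFactorial_eq_prod_range]
    exact congrArg _ (prod_congr rfl fun i _ => by omega)
  have hw := ZMod.factorial_mul_factorial (p := 4 * m + 3) m (3 * m + 2) (by omega)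
  have hne := ZMod.four_mul_factorial_sq_ne_zero (p := 4 * m + 3) hp
  rw [show (4 * m + 3 + 1) / 4 = m + 1 by omega] at hne
  rw [hhalf, eq_mul_inv_iff_mul_eq₀ hne, ← hw, ← hasc, Nat.factorial_succ]
  push_cast
  -- After cancelling common factors, what remains is `4 * (m + 1) = 1`, that is `p = 0`.
  linear_combination (∏ r ∈ Icc 1 (2 * m + 1), ((m : ZMod (4 * m + 3)) + 1 + r)) *
    (m + 1) * (m ! : ZMod (4 * m + 3)) ^ 2 * hp0

theorem theorem1p3 :
    (∀ (F : Type*) [Field F] (n : ℕ) (ζ x : F), 0 < n → IsPrimitiveRoot ζ n →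
      ¬ ringChar F ∣ n → x ^ n ≠ 1 →
      perOneTo n (fun j k => 1 / (1 - ζ ^ ((j : ℤ) - (k : ℤ)) * x)) =
        ∏ r ∈ Finset.Icc 1 n, ((n : F) * x ^ n / (1 - x ^ n) + (r : F))) ∧
    (∀ p : ℕ, p.Prime → p % 4 = 3 →
      RatModEq p
        (perOneTo ((p - 1) / 2) (fun j k => 1 / ((j : ℚ) ^ 2 + (k : ℚ) ^ 2)))
        ((-1) ^ ((p + 1) / 4) / (4 * (Nat.factorial ((p + 1) / 4) : ℚ) ^ 2))) := by
  refine ⟨fun F _ n ζ x hn hζ _ hx => ?_, fun p hp hp4 => ?_⟩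
  · rw [← permanent_one_div_one_sub_root_mul n ζ x hn hζ hx, perOneTo]
    simp
  · have : Fact p.Prime := ⟨hp⟩
    -- A zero denominator would make `-1` a square modulo `p`, impossible for `p % 4 = 3`.
    have hne (j k : Fin ((p - 1) / 2)) :
        (((j.val + 1) ^ 2 + (k.val + 1) ^ 2 : ℕ) : ZMod p) ≠ 0 := by
      have hj := j.2
      intro h0
      have hj0 := ZMod.natCast_ne_zero_of_lt (p := p) (a := j.val + 1) (by omega) (by omega)
      push_cast at h0 hj0
      exact ZMod.mod_four_ne_three_of_sq_eq_neg_sq' hj0 (eq_neg_of_add_eq_zero_right h0) hp4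
    have hres : HasResidue p
        (perOneTo ((p - 1) / 2) (fun j k => 1 / ((j : ℚ) ^ 2 + (k : ℚ) ^ 2)))
        (Matrix.of fun j k : Fin ((p - 1) / 2) =>
          1 / (((j.val + 1 : ℕ) : ZMod p) ^ 2 + ((k.val + 1 : ℕ) : ZMod p) ^ 2)).permanent := by
      refine HasResidue.sum _ fun σ _ => HasResidue.prod _ fun k _ => ?_
      have := HasResidue.inv_natCast (hne (σ k) k)
      push_cast at this
      simpa using this
    rw [ZMod.permanent_one_div_sq_add_sq hp4, ZMod.prod_quarter_add hp4] at hres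
    refine hres.ratModEq ?_
    have := ((HasResidue.intCast (p := p) (-1)).pow ((p + 1) / 4)).mul
      (HasResidue.inv_natCast (ZMod.four_mul_factorial_sq_ne_zero hp4))
    simpa [div_eq_mul_inv] using this
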